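/- A partially ordered abelian group $G$, with positive cone $G^+=\{x\in G: x\ge 0\}$, is called \emph{directed} if any two of its elements have a common upper bound, and \emph{simple} if every nonzero $u\in G^+$ is an order-unit, i.e. for every $x\in G$ there is $n\in\mathbb{N}$ with $x\le nu$. A \emph{Riesz group} is a directed partially ordered abelian group with the interpolation property: whenever $a_0,a_1,b_0,b_1\in G$ satisfy $a_i\le b_j$ for all $i,j$, there is $c\in G$ with $a_i\le c\le b_j$ for all $i,j$. An \emph{interval} of $G^+$ is a nonempty, upward directed lower subset $D$ of $G^+$, and $2D$ denotes the set of all $z\in G^+$ such that $z\le x+y$ for some $x,y\in D$ (if $G$ is a Riesz group, then $2D=\{x+y: x,y\in D\}$). Let $A$ be the submonoid of $\mathbb{Z}^+=\{0,1,2,\dots\}$ generated by $2$ and $7$, let $M$ be the submonoid of $\mathbb{Q}^+$ generated by all elements $\frac{k}{2}\left(\frac{9}{2}\right)^n$ with $k\in A$ and $n\in\mathbb{Z}^+$, and let $G_0=M+(-M)\subseteq\mathbb{Q}$, partially ordered by $x\le y\iff y-x\in M$ (so that $G_0^+=M$). Let $D_0=\{x\in G_0^+:\ x\le (9/2)^n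 \text{ in } G_0 \text{ for some } n\in\mathbb{Z}^+\}$. (1) $G_0$ is a directed simple partially ordered abelian group, and $D_0$ is an interval of $G_0^+$ such that $2D_0=G_0^+$ but $D_0\neq G_0^+$. (2) There are a countable torsion-free simple Riesz group $G$ and an interval $D$ of $G^+$ such that $\{x+y: x,y\in D\}=2D=G^+$ but $D\neq G^+$. Moreover, $G$ and $D$ can be chosen so that there is a group homomorphism $f:G_0\to G$ with $f(x)\le f(y)\iff x\le y$ for all $x,y\in G_0$, with every element of $G$ lying below some element of $f[G_0]$, and with $D=\{x\in G^+:\ x\le f(t)\text{ for some } t\in D_0\}$. -/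

import Mathlib

open scoped Pointwise

namespace SimpleRiesz

section General

variable (G : Type*) [AddCommGroup G] [PartialOrder G]

/-- The positive cone `G⁺` of a partially ordered abelian group. -/
def posCone : Set G := {x | 0 ≤ x}

variable {G} in
/-- `u` is an order-unit: a positive element a multiple of which lies above any given element. -/
def IsOrderUnit (u : G) : Prop := 0 ≤ u ∧ ∀ x : G, ∃ n : ℕ, x ≤ n • u

/-- `G` is simple: every nonzero positive element is an order-unit. -/
def IsSimplePOGroup : Prop := ∀ u : G, 0 < u → IsOrderUnit u

/-- The (finite, Riesz) interpolation property. -/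
def HasInterpolation : Prop :=
  ∀ a₀ a₁ b₀ b₁ : G, a₀ ≤ b₀ → a₀ ≤ b₁ → a₁ ≤ b₀ → a₁ ≤ b₁ →
    ∃ c : G, a₀ ≤ c ∧ a₁ ≤ c ∧ c ≤ b₀ ∧ c ≤ b₁

/-- `G` is directed: any two elements have a common upper bound. -/
def IsDirectedGroup : Prop := ∀ x y : G, ∃ z : G, x ≤ z ∧ y ≤ z

/-- A Riesz group is a directed interpolation group. -/
def IsRieszGroup : Prop := IsDirectedGroup G ∧ HasInterpolation G

variable {G}

/-- An interval of `G⁺`: a nonempty, upward directed lower subset of `G⁺`. -/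
structure IsInterval (D : Set G) : Prop where
  subset_posCone : D ⊆ posCone G
  nonempty : D.Nonempty
  directed : ∀ x ∈ D, ∀ y ∈ D, ∃ z ∈ D, x ≤ z ∧ y ≤ z
  lower : ∀ x ∈ D, ∀ y ∈ posCone G, y ≤ x → y ∈ D

/-- The lower subset of `G⁺` generated by `S` (an interval as soon as `S` is a nonempty upward
directed subset of `G⁺`). -/
def generatedBy (S : Set G) : Set G := {x | x ∈ posCone G ∧ ∃ s ∈ S, x ≤ s}

/-- The sum of two intervals of `G⁺`, i.e. the lower subset of `G⁺` generated by the sums `x + y`.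
(Under interpolation, this is the set of all the sums `x + y`.) -/
def intervalSum (D E : Set G) : Set G := generatedBy (D + E)

end General

section RankOne

/-- The submonoid of `ℤ⁺` generated by `2` and `7`. -/
def A : AddSubmonoid ℕ := AddSubmonoid.closure {2, 7}

/-- The submonoid of `ℚ⁺` generated by the elements `(k/2)(9/2)^n`, `k ∈ A`, `n ∈ ℤ⁺`. -/
def M : AddSubmonoid ℚ :=
  AddSubmonoid.closure {q | ∃ k ∈ A, ∃ n : ℕ, q = ((k : ℚ) / 2) * (9 / 2) ^ n}

theorem M_nonneg {q : ℚ} (hq : q ∈ M) : 0 ≤ q := by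
  induction hq using AddSubmonoid.closure_induction with
  | mem x hx => obtain ⟨k, -, n, rfl⟩ := hx; positivity
  | zero => exact le_rfl
  | add x y _ _ hx hy => exact add_nonneg hx hy

theorem pow_mem_M (n : ℕ) : ((9 : ℚ) / 2) ^ n ∈ M :=
  AddSubmonoid.subset_closure
    ⟨2, AddSubmonoid.subset_closure (by simp), n, by norm_num⟩

/-- The subgroup `M + (-M)` of `ℚ`. -/
def diffSubgroup : AddSubgroup ℚ where
  carrier := {q | ∃ x ∈ M, ∃ y ∈ M, q = x - y}
  zero_mem' := ⟨0, M.zero_mem, 0, M.zero_mem, by simp⟩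
  add_mem' := by
    rintro _ _ ⟨x, hx, y, hy, rfl⟩ ⟨x', hx', y', hy', rfl⟩
    exact ⟨x + x', M.add_mem hx hx', y + y', M.add_mem hy hy', by ring⟩
  neg_mem' := by
    rintro _ ⟨x, hx, y, hy, rfl⟩
    exact ⟨y, hy, x, hx, by ring⟩

/-- The group `G₀ = M + (-M)`. It gets the order with positive cone `M`, not that of `ℚ`. -/
structure G₀ where
  /-- the underlying rational number -/
  val : ℚ
  mem : val ∈ diffSubgroup

namespace G₀

theorem val_injective : Function.Injective G₀.val := by
  rintro ⟨x, hx⟩ ⟨y, hy⟩ h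
  cases h
  rfl

instance : Zero G₀ := ⟨⟨0, diffSubgroup.zero_mem⟩⟩
instance : Add G₀ := ⟨fun x y => ⟨x.val + y.val, diffSubgroup.add_mem x.mem y.mem⟩⟩
instance : Neg G₀ := ⟨fun x => ⟨-x.val, diffSubgroup.neg_mem x.mem⟩⟩
instance : Sub G₀ := ⟨fun x y => ⟨x.val - y.val, diffSubgroup.sub_mem x.mem y.mem⟩⟩
instance : SMul ℕ G₀ := ⟨fun n x => ⟨n • x.val, diffSubgroup.nsmul_mem x.mem n⟩⟩
instance : SMul ℤ G₀ := ⟨fun n x => ⟨n • x.val, diffSubgroup.zsmul_mem x.mem n⟩⟩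

instance : AddCommGroup G₀ :=
  val_injective.addCommGroup G₀.val rfl (fun _ _ => rfl) (fun _ => rfl) (fun _ _ => rfl)
    (fun _ _ => rfl) (fun _ _ => rfl)

instance : PartialOrder G₀ where
  le x y := y.val - x.val ∈ M
  le_refl x := by simp
  le_trans x y z hxy hyz := by
    have := M.add_mem hxy hyz
    rwa [show y.val - x.val + (z.val - y.val) = z.val - x.val by ring] at this
  le_antisymm x y hxy hyx :=
    val_injective (le_antisymm (sub_nonneg.mp (M_nonneg hxy)) (sub_nonneg.mp (M_nonneg hyx)))

instance : IsOrderedAddMonoid G₀ where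
  add_le_add_left x y h z := by
    change y.val + z.val - (x.val + z.val) ∈ M
    rwa [add_sub_add_right_eq_sub]

/-- The element `d_n = (9/2)^n` of `G₀`. -/
def d (n : ℕ) : G₀ := ⟨(9 / 2) ^ n, (9 / 2) ^ n, pow_mem_M n, 0, M.zero_mem, by simp⟩

/-- The interval of `G₀⁺` generated by the increasing sequence `(d_n)`. -/
def D₀ : Set G₀ := generatedBy (Set.range d)

end G₀

end RankOne

end SimpleRiesz

/-!
The interval `D₀` is proper because `2` lies below no `(9/2)^n` in `G₀`: in a representation of
`(9/2)^(n+1) - 2` as an element of `M`, the coefficient of the leading term `(1/2) (9/2)^n` is odd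
(compare the powers of `2` in the denominators), less than `9`, and in `A`, so it is `7`, and removing
the leading term leaves `(9/2)^n - 2` (`pow_sub_two_notMem_M`). On the other hand `2 D₀ = G₀⁺`,
because `2 (9/2)^(n+1) = 9 (9/2)^n` leaves room for any sum of generators.

The second part follows from the first and from a general embedding theorem,
`exists_embedding_isRieszGroup`: a countable torsion-free simple group `G` with a positive element
embeds cofinally into a countable torsion-free simple Riesz group. Properness of the interval
passes to the larger group since `f` is an order embedding, and `2 D` is everything since `f` has
cofinal image.

The embedding theorem rests on adjoining one interpolant `c` between given elements `aᵢ < bⱼ`.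
In the freest extension of the order to `G ⊕ ℤ c`, the positive elements `c - aᵢ` and `bⱼ - c` are
not order-units. Therefore the cone also receives the elements `4 N (c - aᵢ) - t` and
`4 N (bⱼ - c) - t` whenever `t < N (bⱼ - aᵢ)` for all `i` and `j`. In a sum of generators that lies
in `G`, there are as many terms `c - aᵢ` as terms `bⱼ - c`, and when they are paired off, some
difference `bⱼ - aᵢ` occurs often enough to compensate for all the subtracted elements `t`. Thus the
order of `G` does not change (`mem_of_mem_interpolationCone`), and strictness of the inequalities
`t < N (bⱼ - aᵢ)` makes the extension simple (`isSimpleCone_interpolationCone`). A sequence of such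
extensions inside `G ⊕ ℤ^(ℕ)` that is generic in the sense of the Rasiowa–Sikorski lemma has a union
with interpolation.
-/

namespace SimpleRiesz

/-! ### The rank-one group -/

theorem mem_A {k : ℕ} (hk : k ∈ A) : (k = 0 ∨ 2 ≤ k) ∧ (Odd k → 7 ≤ k) := by
  have h : Even k ∨ 7 ≤ k := by
    induction hk using AddSubmonoid.closure_induction with
    | mem x hx =>
      rcases hx with rfl | hx
      · exact Or.inl even_two
      · rw [Set.mem_singleton_iff] at hx
        omega
    | zero => simp
    | add x y _ _ hx hy =>
      rcases hx with hx | hx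
      · rcases hy with hy | hy
        · exact Or.inl (hx.add hy)
        · omega
      · omega
  rcases h with ⟨r, rfl⟩ | h
  · exact ⟨by omega, fun ⟨s, hs⟩ => by omega⟩
  · exact ⟨by omega, fun _ => h⟩

theorem generator_mem_M {k : ℕ} (hk : k ∈ A) (n : ℕ) : (k : ℚ) / 2 * (9 / 2) ^ n ∈ M :=
  AddSubmonoid.subset_closure ⟨k, hk, n, rfl⟩

theorem pow_sub_pow_mem_M {m n : ℕ} (h : m ≤ n) : ((9 : ℚ) / 2) ^ n - (9 / 2) ^ m ∈ M := by
  induction n, h using Nat.le_induction with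
  | base => simp
  | succ n _ ih =>
    have h7 := generator_mem_M (AddSubmonoid.subset_closure (by simp) : 7 ∈ A) n
    convert M.add_mem ih h7 using 1
    push_cast
    ring

theorem exists_two_mul_pow_sub_mem_M {q : ℚ} (hq : q ∈ M) :
    ∃ n : ℕ, 2 * ((9 : ℚ) / 2) ^ n - q ∈ M := by
  have hadd : ∀ x y : ℚ, (∃ n : ℕ, 2 * ((9 : ℚ) / 2) ^ n - x ∈ M) →
      (∃ n : ℕ, 2 * ((9 : ℚ) / 2) ^ n - y ∈ M) →
      ∃ n : ℕ, 2 * ((9 : ℚ) / 2) ^ n - (x + y) ∈ M := by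
    rintro x y ⟨m, hm⟩ ⟨n, hn⟩
    -- `2 (9/2) ^ (l + 1) = 9 (9/2) ^ l` leaves room for two copies of `2 (9/2) ^ l`
    refine ⟨max m n + 1, ?_⟩
    have h1 := M.nsmul_mem (pow_sub_pow_mem_M (le_max_left m n)) 2
    have h2 := M.nsmul_mem (pow_sub_pow_mem_M (le_max_right m n)) 2
    have h3 := M.nsmul_mem (pow_mem_M (max m n)) 5
    convert M.add_mem (M.add_mem (M.add_mem hm h1) (M.add_mem hn h2)) h3 using 1
    simp only [nsmul_eq_mul]
    push_cast
    ring
  induction hq using AddSubmonoid.closure_induction with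
  | mem x hx =>
    obtain ⟨k, hk, i, rfl⟩ := hx
    have hpow : ∃ n : ℕ, 2 * ((9 : ℚ) / 2) ^ n - (9 / 2) ^ i ∈ M :=
      ⟨i, by convert pow_mem_M i using 1; ring⟩
    have hmul : ∀ k : ℕ, ∃ n : ℕ, 2 * ((9 : ℚ) / 2) ^ n - k * (9 / 2) ^ i ∈ M := by
      intro k
      induction k with
      | zero => exact ⟨0, by simpa using M.nsmul_mem (pow_mem_M 0) 2⟩
      | succ k ih =>
        obtain ⟨n, hn⟩ := hadd _ _ ih hpow
        exact ⟨n, by convert hn using 1; push_cast; ring⟩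
    obtain ⟨n, hn⟩ := hmul k
    exact ⟨n, by convert M.add_mem hn (generator_mem_M hk i) using 1; ring⟩
  | zero => exact ⟨0, by simpa using M.nsmul_mem (pow_mem_M 0) 2⟩
  | add x y _ _ hx hy => exact hadd x y hx hy

theorem exists_two_mul_sub_pow_mem_M {q : ℚ} (hq : q ∈ M) (h0 : q ≠ 0) :
    ∃ n : ℕ, 2 * q - (9 / 2) ^ n ∈ M := by
  suffices h : q = 0 ∨ ∃ n : ℕ, 2 * q - (9 / 2) ^ n ∈ M from h.resolve_left h0
  clear h0
  induction hq using AddSubmonoid.closure_induction with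
  | mem x hx =>
    obtain ⟨k, hk, n, rfl⟩ := hx
    rcases (mem_A hk).1 with rfl | h2
    · simp
    · refine Or.inr ⟨n, ?_⟩
      obtain ⟨l, rfl⟩ := Nat.exists_eq_add_of_le h2
      convert M.nsmul_mem (pow_mem_M n) (l + 1) using 1
      simp only [nsmul_eq_mul]
      push_cast
      ring
  | zero => exact Or.inl rfl
  | add x y hxM hyM hx hy =>
    rcases hx with rfl | ⟨n, hn⟩
    · simpa using hy
    · refine Or.inr ⟨n, ?_⟩
      convert M.add_mem hn (M.nsmul_mem hyM 2) using 1
      simp only [nsmul_eq_mul]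
      push_cast
      ring

theorem nsmul_pow_sub_pow_mem_M (m n : ℕ) :
    2 * 9 ^ m * ((9 : ℚ) / 2) ^ n - 2 * (9 / 2) ^ m ∈ M := by
  induction m with
  | zero =>
    convert M.nsmul_mem (pow_sub_pow_mem_M (Nat.zero_le n)) 2 using 1
    simp only [nsmul_eq_mul]
    push_cast
    ring
  | succ m ih =>
    convert M.add_mem (M.nsmul_mem ih 9) (M.nsmul_mem (pow_mem_M m) 9) using 1
    simp only [nsmul_eq_mul]
    push_cast
    ring

/-- The sums `∑_{i < n} (k_i / 2) (9 / 2) ^ i` with all `k_i` in `A`, built from the leading term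
down. -/
inductive IsDigitSum : ℕ → ℚ → Prop
  | zero : IsDigitSum 0 0
  | succ {n : ℕ} {y : ℚ} {k : ℕ} (hy : IsDigitSum n y) (hk : k ∈ A) :
      IsDigitSum (n + 1) (y + (k : ℚ) / 2 * (9 / 2) ^ n)

namespace IsDigitSum

theorem of_zero : ∀ n, IsDigitSum n 0
  | 0 => zero
  | n + 1 => by simpa using (of_zero n).succ A.zero_mem

theorem add {n : ℕ} {x y : ℚ} (hx : IsDigitSum n x) (hy : IsDigitSum n y) :
    IsDigitSum n (x + y) := by
  induction hx generalizing y with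
  | zero => simpa using hy
  | succ _ hk ih =>
    cases hy with
    | succ hy hl =>
      convert (ih hy).succ (A.add_mem hk hl) using 1
      push_cast
      ring

theorem generator {k i n : ℕ} (hk : k ∈ A) (h : i < n) :
    IsDigitSum n ((k : ℚ) / 2 * (9 / 2) ^ i) := by
  induction n, h using Nat.le_induction with
  | base => simpa using (of_zero i).succ hk
  | succ n _ ih => simpa using ih.succ A.zero_mem

theorem nonneg {n : ℕ} {x : ℚ} (hx : IsDigitSum n x) : 0 ≤ x := by
  induction hx with
  | zero => exact le_rfl
  | succ _ _ ih => positivity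

theorem exists_mul_two_pow {n : ℕ} {x : ℚ} (hx : IsDigitSum n x) :
    ∃ z : ℤ, x * 2 ^ n = z := by
  induction hx with
  | zero => exact ⟨0, by simp⟩
  | @succ n y k _ _ ih =>
    obtain ⟨z, hz⟩ := ih
    refine ⟨2 * z + k * 9 ^ n, ?_⟩
    push_cast
    rw [← hz, div_pow]
    field_simp
    ring

end IsDigitSum

/-- An element of `M` smaller than `(9 / 2) ^ n` only involves powers below the `n`-th. -/
theorem le_or_isDigitSum (n : ℕ) {q : ℚ} (hq : q ∈ M) : (9 / 2) ^ n ≤ q ∨ IsDigitSum n q := by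
  induction hq using AddSubmonoid.closure_induction with
  | mem x hx =>
    obtain ⟨k, hk, i, rfl⟩ := hx
    rcases lt_or_ge i n with hi | hi
    · exact Or.inr (.generator hk hi)
    rcases (mem_A hk).1 with rfl | h2
    · exact Or.inr (by simpa using IsDigitSum.of_zero n)
    · left
      have h1 : (1 : ℚ) ≤ (k : ℚ) / 2 := by
        have : (2 : ℚ) ≤ k := by exact_mod_cast h2
        linarith
      have h3 : ((9 : ℚ) / 2) ^ n ≤ (9 / 2) ^ i := pow_le_pow_right₀ (by norm_num) hi
      have h4 : (0 : ℚ) ≤ (9 / 2) ^ i := by positivity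
      nlinarith
  | zero => exact Or.inr (.of_zero n)
  | add x y hxM hyM hx hy =>
    rcases hx with hx | hx
    · exact Or.inl (hx.trans (le_add_of_nonneg_right (M_nonneg hyM)))
    rcases hy with hy | hy
    · exact Or.inl (hy.trans (le_add_of_nonneg_left (M_nonneg hxM)))
    · exact Or.inr (hx.add hy)

theorem not_isDigitSum_pow_sub_two (n : ℕ) : ¬ IsDigitSum n ((9 / 2) ^ n - 2) := by
  induction n with
  | zero => exact fun h => by have := h.nonneg; norm_num at this
  | succ n ih =>
    intro h
    generalize hx : ((9 : ℚ) / 2) ^ (n + 1) - 2 = x at h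
    obtain _ | @⟨_, y, k, hy, hk⟩ := h
    obtain ⟨z, hz⟩ := hy.exists_mul_two_pow
    have hpos : (0 : ℚ) < (9 / 2) ^ n := by positivity
    -- the leading digit is less than `9`, because the sum is less than `(9 / 2) ^ (n + 1)`
    have hk9 : k < 9 := by
      have h0 := hy.nonneg
      have : (k : ℚ) < 9 := by
        by_contra! h9
        have := mul_le_mul_of_nonneg_right h9 hpos.le
        rw [pow_succ] at hx
        linarith
      exact_mod_cast this
    -- it is odd, as one sees after multiplication by `2 ^ (n + 1)`
    have hodd : Odd k := by
      have key : (9 : ℤ) ^ (n + 1) = 2 * (z + 2 ^ (n + 1)) + k * 9 ^ n := by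
        have : (9 : ℚ) ^ (n + 1) = 2 * (z + 2 ^ (n + 1)) + k * 9 ^ n := by
          rw [← hz]
          have hy' : y = (9 / 2) ^ (n + 1) - 2 - (k : ℚ) / 2 * (9 / 2) ^ n := by linarith
          rw [hy', div_pow, div_pow]
          field_simp
          ring
        exact_mod_cast this
      by_contra hev
      rw [Nat.not_odd_iff_even] at hev
      have h1 : Odd ((9 : ℤ) ^ (n + 1)) := Odd.pow (by decide)
      have h2 : Even ((k : ℤ) * 9 ^ n) := ((Int.even_coe_nat k).2 hev).mul_right _
      rw [key] at h1
      exact (Int.not_even_iff_odd.2 h1) ((even_two_mul _).add h2)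
    have h7 : k = 7 := by
      have := (mem_A hk).2 hodd
      obtain ⟨r, rfl⟩ := hodd
      omega
    subst h7
    apply ih
    convert hy using 1
    push_cast at hx
    rw [pow_succ] at hx
    linarith

theorem pow_sub_two_notMem_M (n : ℕ) : ((9 : ℚ) / 2) ^ n - 2 ∉ M := fun h =>
  (le_or_isDigitSum n h).elim (fun h => by linarith) (not_isDigitSum_pow_sub_two n)

namespace G₀

theorem val_add (x y : G₀) : (x + y).val = x.val + y.val := rfl

theorem val_nsmul (n : ℕ) (x : G₀) : (n • x).val = n * x.val :=
  nsmul_eq_mul n x.val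

theorem le_iff {x y : G₀} : x ≤ y ↔ y.val - x.val ∈ M := Iff.rfl

theorem nonneg_iff {x : G₀} : 0 ≤ x ↔ x.val ∈ M := by
  rw [le_iff]
  exact iff_of_eq (congrArg (· ∈ M) (sub_zero x.val))

/-- The inclusion of `G₀` into `ℚ`, as a homomorphism. -/
def valHom : G₀ →+ ℚ where
  toFun := val
  map_zero' := rfl
  map_add' _ _ := rfl

instance : Countable G₀ := val_injective.countable

instance : IsAddTorsionFree G₀ :=
  Function.Injective.isAddTorsionFree valHom val_injective

theorem d_monotone : Monotone d := fun _ _ h => pow_sub_pow_mem_M h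

theorem d_pos (n : ℕ) : 0 < d n := by
  refine lt_of_le_of_ne (nonneg_iff.2 (pow_mem_M n)) fun h => ?_
  have h0 : (0 : ℚ) = (9 / 2) ^ n := congrArg val h
  exact absurd h0 (by positivity)

theorem exists_le_d_add_d (x : G₀) : ∃ n, x ≤ d n + d n := by
  obtain ⟨p, hp, q, hq, hx⟩ := x.mem
  obtain ⟨n, hn⟩ := exists_two_mul_pow_sub_mem_M hp
  refine ⟨n, le_iff.2 ?_⟩
  convert M.add_mem hn hq using 1
  rw [hx, val_add]
  simp only [d]
  ring

theorem isSimplePOGroup : IsSimplePOGroup G₀ := by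
  intro u hu
  refine ⟨hu.le, fun x => ?_⟩
  obtain ⟨n, hn⟩ := exists_two_mul_sub_pow_mem_M (nonneg_iff.1 hu.le)
    (fun h => hu.ne (val_injective h.symm))
  obtain ⟨m, hm⟩ := exists_le_d_add_d x
  refine ⟨2 * 9 ^ m * 2, hm.trans (le_iff.2 ?_)⟩
  convert M.add_mem (nsmul_pow_sub_pow_mem_M m n) (M.nsmul_mem hn (2 * 9 ^ m)) using 1
  simp only [val_add, val_nsmul, nsmul_eq_mul, d]
  push_cast
  ring

theorem isInterval_D₀ : IsInterval D₀ where
  subset_posCone _ hx := hx.1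
  nonempty := ⟨d 0, (d_pos 0).le, d 0, ⟨0, rfl⟩, le_rfl⟩
  directed := by
    rintro x ⟨-, _, ⟨m, rfl⟩, hx⟩ y ⟨-, _, ⟨n, rfl⟩, hy⟩
    exact ⟨d (max m n), ⟨(d_pos _).le, _, ⟨_, rfl⟩, le_rfl⟩,
      hx.trans (d_monotone (le_max_left m n)), hy.trans (d_monotone (le_max_right m n))⟩
  lower := by
    rintro x ⟨-, s, hs, hx⟩ y hy hyx
    exact ⟨hy, s, hs, hyx.trans hx⟩

theorem d_mem_D₀ (n : ℕ) : d n ∈ D₀ := ⟨(d_pos n).le, d n, ⟨n, rfl⟩, le_rfl⟩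

theorem intervalSum_D₀ : intervalSum D₀ D₀ = posCone G₀ := by
  refine Set.Subset.antisymm (fun _ hx => hx.1) fun x hx => ?_
  obtain ⟨n, hn⟩ := exists_le_d_add_d x
  exact ⟨hx, _, Set.add_mem_add (d_mem_D₀ n) (d_mem_D₀ n), hn⟩

theorem two_nsmul_d_zero_notMem_D₀ : 2 • d 0 ∉ D₀ := by
  rintro ⟨-, _, ⟨n, rfl⟩, hn⟩
  refine pow_sub_two_notMem_M n ?_
  convert le_iff.1 hn using 1
  simp [val_nsmul, d]

theorem D₀_ne_posCone : D₀ ≠ posCone G₀ := fun h =>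
  two_nsmul_d_zero_notMem_D₀ (h ▸ nsmul_nonneg (d_pos 0).le 2)

end G₀

/-! ### Adjoining one interpolant to a simple cone -/

section Interpolant

variable {E : Type*} [AddCommGroup E]

/-- `P` is the positive cone of a partial order on the subgroup `H` under which `H` is simple. -/
structure IsSimpleCone (H : AddSubgroup E) (P : AddSubmonoid E) : Prop where
  mem : ∀ x ∈ P, x ∈ H
  eq_zero : ∀ x ∈ P, -x ∈ P → x = 0
  unit : ∀ u ∈ P, u ≠ 0 → ∀ x ∈ H, ∃ n : ℕ, n • u - x ∈ P

/-- The strict inequality `0 < x` in the order with positive cone `P`. -/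
def StrictPos (P : AddSubmonoid E) (x : E) : Prop := x ∈ P ∧ x ≠ 0

namespace IsSimpleCone

variable {H : AddSubgroup E} {P : AddSubmonoid E}

theorem strictPos_add (hP : IsSimpleCone H P) {x y : E} (hx : StrictPos P x) (hy : y ∈ P) :
    StrictPos P (x + y) := by
  refine ⟨P.add_mem hx.1 hy, fun h => hx.2 (hP.eq_zero x hx.1 ?_)⟩
  rwa [neg_eq_of_add_eq_zero_right h]

/-- Finitely many order-units have a common multiple strictly above a given element. -/
theorem exists_nsmul_sub_strictPos (hP : IsSimpleCone H P) {ι : Type*} [Finite ι] {u : ι → E}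
    (hu : ∀ i, StrictPos P (u i)) {x : E} (hx : x ∈ H) :
    ∃ n : ℕ, ∀ i, StrictPos P (n • u i - x) := by
  choose n hn using fun i => hP.unit (u i) (hu i).1 (hu i).2 x hx
  obtain ⟨N, hN⟩ := (Set.finite_range n).bddAbove
  refine ⟨N + 1, fun i => ?_⟩
  obtain ⟨l, hl⟩ := Nat.exists_eq_add_of_le (hN ⟨i, rfl⟩)
  convert hP.strictPos_add (hu i) (P.add_mem (P.nsmul_mem (hu i).1 l) (hn i)) using 1
  rw [hl]
  module

end IsSimpleCone

/-- The combination `∑ αᵢ (c - aᵢ) + ∑ βⱼ (bⱼ - c)`. -/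
def combination (a b : Fin 2 → E) (c : E) (α β : Fin 2 → ℕ) : E :=
  α 0 • (c - a 0) + α 1 • (c - a 1) + β 0 • (b 0 - c) + β 1 • (b 1 - c)

theorem combination_add (a b : Fin 2 → E) (c : E) (α β α' β' : Fin 2 → ℕ) :
    combination a b c (α + α') (β + β') = combination a b c α β + combination a b c α' β' := by
  simp only [combination, Pi.add_apply]
  module

theorem combination_nsmul (a b : Fin 2 → E) (c : E) (α β : Fin 2 → ℕ) (n : ℕ) :
    combination a b c (n • α) (n • β) = n • combination a b c α β := by
  simp only [combination, Pi.smul_apply, smul_eq_mul]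
  module

@[simp]
theorem combination_zero (a b : Fin 2 → E) (c : E) : combination a b c 0 0 = 0 := by
  simp [combination]

/-- The number of terms of a combination. -/
def weight (α β : Fin 2 → ℕ) : ℕ := α 0 + α 1 + (β 0 + β 1)

/-- `t` is negligible against `N`: either `t ≤ 0`, or `t < N (bⱼ - aᵢ)` for all `i` and `j`. -/
def IsNegligible (P : AddSubmonoid E) (a b : Fin 2 → E) (N : ℕ) (t : E) : Prop :=
  -t ∈ P ∨ ∀ i j, StrictPos P (N • (b j - a i) - t)

theorem IsNegligible.add {H : AddSubgroup E} {P : AddSubmonoid E} (hP : IsSimpleCone H P)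
    {a b : Fin 2 → E} (hab : ∀ i j, StrictPos P (b j - a i)) {N N' : ℕ} {t t' : E}
    (h : IsNegligible P a b N t) (h' : IsNegligible P a b N' t') :
    IsNegligible P a b (N + N') (t + t') := by
  rcases h with h | h <;> rcases h' with h' | h'
  · left
    rw [neg_add]
    exact P.add_mem h h'
  · refine Or.inr fun i j => ?_
    convert hP.strictPos_add (h' i j) (P.add_mem h (P.nsmul_mem (hab i j).1 N)) using 1
    module
  · refine Or.inr fun i j => ?_
    convert hP.strictPos_add (h i j) (P.add_mem h' (P.nsmul_mem (hab i j).1 N')) using 1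
    module
  · refine Or.inr fun i j => ?_
    convert hP.strictPos_add (h i j) (h' i j).1 using 1
    module

/-- The positive cone on `H + ℤ c` that makes `c` an interpolant between the `aᵢ` and the `bⱼ`:
its elements are the combinations of the `c - aᵢ` and `bⱼ - c` from which is subtracted an element
of `H` that is negligible against a quarter of the number of terms. Without this subtraction,
`c - aᵢ` would not be an order-unit. -/
def interpolationCone {H : AddSubgroup E} {P : AddSubmonoid E} (hP : IsSimpleCone H P)
    {a b : Fin 2 → E} (hab : ∀ i j, StrictPos P (b j - a i)) (c : E) : AddSubmonoid E where
  carrier := {w | ∃ (α β : Fin 2 → ℕ) (N : ℕ) (t : E), t ∈ H ∧ 4 * N ≤ weight α β ∧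
    IsNegligible P a b N t ∧ w = combination a b c α β - t}
  zero_mem' := ⟨0, 0, 0, 0, H.zero_mem, by simp, Or.inl (by simp), by simp⟩
  add_mem' := by
    rintro _ _ ⟨α, β, N, t, ht, hN, h, rfl⟩ ⟨α', β', N', t', ht', hN', h', rfl⟩
    refine ⟨α + α', β + β', N + N', t + t', H.add_mem ht ht', ?_, h.add hP hab h', ?_⟩
    · simp only [weight, Pi.add_apply] at *
      omega
    · rw [combination_add]
      abel

variable {H : AddSubgroup E} {P : AddSubmonoid E} (hP : IsSimpleCone H P)
  {a b : Fin 2 → E} (hab : ∀ i j, StrictPos P (b j - a i)) {c : E}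

theorem le_interpolationCone : P ≤ interpolationCone hP hab c := fun x hx =>
  ⟨0, 0, 0, -x, H.neg_mem (hP.mem x hx), by simp, Or.inl (by simpa using hx), by simp⟩

theorem sub_lower_mem_interpolationCone (i : Fin 2) : c - a i ∈ interpolationCone hP hab c := by
  refine ⟨Pi.single i 1, 0, 0, 0, H.zero_mem, by simp, Or.inl (by simp), ?_⟩
  fin_cases i <;> simp [combination]

theorem upper_sub_mem_interpolationCone (j : Fin 2) : b j - c ∈ interpolationCone hP hab c := by
  refine ⟨0, Pi.single j 1, 0, 0, H.zero_mem, by simp, Or.inl (by simp), ?_⟩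
  fin_cases j <;> simp [combination]

/-- When there are as many lower as upper terms, the terms pair off into differences
`bⱼ - aᵢ`. -/
theorem combination_mem_of_balanced (hab : ∀ i j, StrictPos P (b j - a i)) (c : E)
    {α β : Fin 2 → ℕ} (h : α 0 + α 1 = β 0 + β 1) : combination a b c α β ∈ P := by
  have key : ∀ i j (n : ℕ), n • (b j - a i) ∈ P := fun i j n => P.nsmul_mem (hab i j).1 n
  rcases le_total (α 0) (β 0) with hle | hle
  · obtain ⟨l, hl⟩ := Nat.exists_eq_add_of_le hle
    have h1 : α 1 = l + β 1 := by omega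
    convert P.add_mem (P.add_mem (key 0 0 (α 0)) (key 1 0 l)) (key 1 1 (β 1)) using 1
    rw [combination, hl, h1]
    module
  · obtain ⟨l, hl⟩ := Nat.exists_eq_add_of_le hle
    have h1 : β 1 = l + α 1 := by omega
    convert P.add_mem (P.add_mem (key 0 0 (β 0)) (key 0 1 l)) (key 1 1 (α 1)) using 1
    rw [combination, hl, h1]
    module

/-- With as many lower as upper terms, `bⱼ - aᵢ` can be paired off `N` times if there are `N` terms
of each of the two kinds. -/
theorem combination_sub_mem_of_balanced (hab : ∀ i j, StrictPos P (b j - a i)) (c : E)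
    {α β : Fin 2 → ℕ} {N : ℕ} (h : α 0 + α 1 = β 0 + β 1) {i j : Fin 2} (hi : N ≤ α i)
    (hj : N ≤ β j) : combination a b c α β - N • (b j - a i) ∈ P := by
  have hle : ∀ {f : Fin 2 → ℕ} {i : Fin 2}, N ≤ f i → Pi.single i N ≤ f := by
    intro f i hi l
    rcases eq_or_ne l i with rfl | hne
    · simpa using hi
    · simp [hne]
  have hα : α = (α - Pi.single i N) + Pi.single i N := (tsub_add_cancel_of_le (hle hi)).symm
  have hβ : β = (β - Pi.single j N) + Pi.single j N := (tsub_add_cancel_of_le (hle hj)).symm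
  have hs : combination a b c (Pi.single i N) (Pi.single j N) = N • (b j - a i) := by
    fin_cases i <;> fin_cases j <;> simp [combination] <;> module
  rw [hα, hβ, combination_add, hs, add_sub_cancel_right]
  refine combination_mem_of_balanced hab c ?_
  have hsum : ∀ i : Fin 2, (Pi.single i N : Fin 2 → ℕ) 0 + (Pi.single i N : Fin 2 → ℕ) 1 = N := by
    intro i
    fin_cases i <;> simp
  have h1 := hsum i
  have h2 := hsum j
  have e0 := congrFun hα 0
  have e1 := congrFun hα 1
  have f0 := congrFun hβ 0
  have f1 := congrFun hβ 1
  simp only [Pi.add_apply] at e0 e1 f0 f1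
  omega

/-- A negligible element lies strictly below any balanced combination with at least one term. -/
theorem combination_sub_strictPos (hP : IsSimpleCone H P) (hab : ∀ i j, StrictPos P (b j - a i))
    {α β : Fin 2 → ℕ} {N : ℕ} {t : E} (h : α 0 + α 1 = β 0 + β 1) (hN : 4 * N ≤ weight α β)
    (h0 : weight α β ≠ 0) (ht : IsNegligible P a b N t) :
    StrictPos P (combination a b c α β - t) := by
  simp only [weight] at hN h0
  -- one of two numbers with sum at least `2 n - 1` is at least `n`
  have hmax : ∀ (f : Fin 2 → ℕ) (n : ℕ), 2 * n ≤ f 0 + f 1 + 1 → ∃ i, n ≤ f i := by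
    intro f n hf
    by_contra! hlt
    have := hlt 0
    have := hlt 1
    omega
  rcases ht with ht | ht
  · obtain ⟨i, hi⟩ := hmax α 1 (by omega)
    obtain ⟨j, hj⟩ := hmax β 1 (by omega)
    convert hP.strictPos_add (hab i j)
      (P.add_mem (combination_sub_mem_of_balanced hab c h hi hj) ht) using 1
    module
  · obtain ⟨i, hi⟩ := hmax α N (by omega)
    obtain ⟨j, hj⟩ := hmax β N (by omega)
    convert hP.strictPos_add (ht i j) (combination_sub_mem_of_balanced hab c h hi hj) using 1
    module

theorem combination_eq (a b : Fin 2 → E) (c : E) (α β : Fin 2 → ℕ) :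
    combination a b c α β = (β 0 • b 0 + β 1 • b 1 - (α 0 • a 0 + α 1 • a 1)) +
      (((α 0 + α 1 : ℕ) : ℤ) - ((β 0 + β 1 : ℕ) : ℤ)) • c := by
  rw [combination]
  push_cast
  module

/-- A combination that lies in `H` has as many lower as upper terms. -/
theorem balanced_of_mem (ha : ∀ i, a i ∈ H) (hb : ∀ j, b j ∈ H)
    (hc : ∀ k : ℤ, k • c ∈ H → k = 0) {α β : Fin 2 → ℕ} (h : combination a b c α β ∈ H) :
    α 0 + α 1 = β 0 + β 1 := by
  rw [combination_eq, H.add_mem_cancel_left] at h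
  · have := hc _ h
    omega
  · exact H.sub_mem (H.add_mem (H.nsmul_mem (hb 0) _) (H.nsmul_mem (hb 1) _))
      (H.add_mem (H.nsmul_mem (ha 0) _) (H.nsmul_mem (ha 1) _))

theorem eq_zero_of_weight_eq_zero {α β : Fin 2 → ℕ} (h : weight α β = 0) : α = 0 ∧ β = 0 := by
  simp only [weight] at h
  constructor <;> funext i <;> fin_cases i <;> simp <;> omega

theorem IsNegligible.neg_mem {P : AddSubmonoid E} {a b : Fin 2 → E} {t : E}
    (h : IsNegligible P a b 0 t) : -t ∈ P :=
  h.elim id fun h => by simpa using (h 0 0).1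

/-- The order on `H` does not change when the interpolant is adjoined. -/
theorem mem_of_mem_interpolationCone (ha : ∀ i, a i ∈ H) (hb : ∀ j, b j ∈ H)
    (hc : ∀ k : ℤ, k • c ∈ H → k = 0) {x : E} (hx : x ∈ interpolationCone hP hab c)
    (hxH : x ∈ H) : x ∈ P := by
  obtain ⟨α, β, N, t, ht, hN, h, rfl⟩ := hx
  have hbal : α 0 + α 1 = β 0 + β 1 :=
    balanced_of_mem ha hb hc (by simpa using H.add_mem hxH ht)
  rcases eq_or_ne (weight α β) 0 with h0 | h0
  · obtain ⟨rfl, rfl⟩ := eq_zero_of_weight_eq_zero h0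
    obtain rfl : N = 0 := by omega
    simpa using h.neg_mem
  · exact (combination_sub_strictPos hP hab hbal hN h0 h).1

theorem exists_mem_sub_mem_interpolationCone (ha : ∀ i, a i ∈ H) (hb : ∀ j, b j ∈ H)
    {h : E} (hh : h ∈ H) (k : ℤ) : ∃ y ∈ H, y - (h + k • c) ∈ interpolationCone hP hab c := by
  obtain ⟨n, rfl | rfl⟩ := k.eq_nat_or_neg
  · refine ⟨h + n • b 0, H.add_mem hh (H.nsmul_mem (hb 0) n), ?_⟩
    convert AddSubmonoid.nsmul_mem _ (upper_sub_mem_interpolationCone hP hab (c := c) 0) n using 1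
    module
  · refine ⟨h - n • a 0, H.sub_mem hh (H.nsmul_mem (ha 0) n), ?_⟩
    convert AddSubmonoid.nsmul_mem _ (sub_lower_mem_interpolationCone hP hab (c := c) 0) n using 1
    module

theorem isSimpleCone_interpolationCone (ha : ∀ i, a i ∈ H) (hb : ∀ j, b j ∈ H)
    (hc : ∀ k : ℤ, k • c ∈ H → k = 0) {H' : AddSubgroup E} (hH : H ≤ H') (hcH : c ∈ H')
    (hH' : ∀ x ∈ H', ∃ h ∈ H, ∃ k : ℤ, x = h + k • c) :
    IsSimpleCone H' (interpolationCone hP hab c) where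
  mem := by
    rintro _ ⟨α, β, N, t, ht, -, -, rfl⟩
    have hl : ∀ i, c - a i ∈ H' := fun i => H'.sub_mem hcH (hH (ha i))
    have hu : ∀ j, b j - c ∈ H' := fun j => H'.sub_mem (hH (hb j)) hcH
    exact H'.sub_mem (H'.add_mem (H'.add_mem (H'.add_mem (H'.nsmul_mem (hl 0) _)
      (H'.nsmul_mem (hl 1) _)) (H'.nsmul_mem (hu 0) _)) (H'.nsmul_mem (hu 1) _)) (hH ht)
  eq_zero := by
    rintro x ⟨α, β, N, t, ht, hN, h, hx⟩ ⟨α', β', N', t', ht', hN', h', hx'⟩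
    have hsum : combination a b c (α + α') (β + β') - (t + t') = 0 := by
      rw [combination_add, add_sub_add_comm, ← hx, ← hx', add_neg_cancel]
    have hbal : (α + α') 0 + (α + α') 1 = (β + β') 0 + (β + β') 1 :=
      balanced_of_mem ha hb hc (by rw [sub_eq_zero.1 hsum]; exact H.add_mem ht ht')
    have hw : weight (α + α') (β + β') = weight α β + weight α' β' := by
      simp only [weight, Pi.add_apply]
      omega
    -- the sum of the two representations vanishes, hence has no terms at all
    have h0 : weight (α + α') (β + β') = 0 := by
      by_contra hne
      exact (combination_sub_strictPos hP hab (N := N + N') hbal (by omega) hne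
        (h.add hP hab h')).2 hsum
    obtain ⟨rfl, rfl⟩ := eq_zero_of_weight_eq_zero (α := α) (β := β) (by omega)
    obtain ⟨rfl, rfl⟩ := eq_zero_of_weight_eq_zero (α := α') (β := β') (by omega)
    obtain rfl : N = 0 := by omega
    obtain rfl : N' = 0 := by omega
    simp only [combination_zero, zero_sub] at hx hx'
    exact hP.eq_zero x (hx ▸ h.neg_mem) (hx' ▸ h'.neg_mem)
  unit := by
    rintro u ⟨α, β, N, t, ht, hN, h, rfl⟩ hu0 x hx
    obtain ⟨g, hg, k, rfl⟩ := hH' x hx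
    obtain ⟨y, hy, hyx⟩ := exists_mem_sub_mem_interpolationCone hP hab ha hb hg k
    -- it is enough to find a multiple of `u` above the element `y` of `H`
    suffices hn : ∃ n : ℕ, n • (combination a b c α β - t) - y ∈ interpolationCone hP hab c by
      obtain ⟨n, hn⟩ := hn
      refine ⟨n, ?_⟩
      convert AddSubmonoid.add_mem _ hn hyx using 1
      abel
    rcases eq_or_ne (weight α β) 0 with h0 | h0
    · obtain ⟨rfl, rfl⟩ := eq_zero_of_weight_eq_zero h0
      obtain rfl : N = 0 := by omega
      rw [combination_zero, zero_sub] at hu0 ⊢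
      obtain ⟨n, hn⟩ := hP.unit (-t) h.neg_mem hu0 y hy
      exact ⟨n, le_interpolationCone hP hab hn⟩
    rcases h with h | h
    · obtain ⟨n, hn⟩ := hP.exists_nsmul_sub_strictPos
        (u := fun p : Fin 2 × Fin 2 => b p.2 - a p.1) (fun p => hab p.1 p.2) hy
      -- `u` is at least one of its terms, and `4 n` of these terms exceed `y`
      refine ⟨4 * n, (4 * n) • α, (4 * n) • β, n, (4 * n) • t + y,
        H.add_mem (H.nsmul_mem ht _) hy, ?_, Or.inr fun i j => ?_, ?_⟩
      · have : weight ((4 * n) • α) ((4 * n) • β) = 4 * n * weight α β := by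
          simp only [weight, Pi.smul_apply, smul_eq_mul]
          ring
        rw [this]
        exact Nat.le_mul_of_pos_right _ (Nat.pos_of_ne_zero h0)
      · convert hP.strictPos_add (hn (i, j)) (P.nsmul_mem h (4 * n)) using 1
        module
      · rw [combination_nsmul]
        module
    · -- the strict inequalities `t < N (bⱼ - aᵢ)` leave room for `y` in a multiple of `u`
      obtain ⟨n, hn⟩ := hP.exists_nsmul_sub_strictPos
        (u := fun p : Fin 2 × Fin 2 => N • (b p.2 - a p.1) - t) (fun p => h p.1 p.2) hy
      refine ⟨n, n • α, n • β, n * N, n • t + y,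
        H.add_mem (H.nsmul_mem ht _) hy, ?_, Or.inr fun i j => ?_, ?_⟩
      · have : weight (n • α) (n • β) = n * weight α β := by
          simp only [weight, Pi.smul_apply, smul_eq_mul]
          ring
        rw [this]
        nlinarith
      · convert hn (i, j) using 1
        module
      · rw [combination_nsmul]
        module

end Interpolant

/-! ### The generic increasing union of simple cones -/

section Union

variable {G : Type*} [AddCommGroup G]

variable (G) in
/-- The subgroup `G ⊕ ℤⁿ` of `G ⊕ ℤ^(ℕ)`. -/
noncomputable def level (n : ℕ) : AddSubgroup (G × (ℕ →₀ ℤ)) where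
  carrier := {x | ∀ m, n ≤ m → x.2 m = 0}
  zero_mem' := by simp
  add_mem' hx hy m hm := by simp [hx m hm, hy m hm]
  neg_mem' hx m hm := by simp [hx m hm]

theorem level_mono : Monotone (level G) := fun _ _ h _ hx m hm => hx m (h.trans hm)

theorem inl_mem_level (n : ℕ) (g : G) : (g, 0) ∈ level G n := fun _ _ => rfl

theorem exists_mem_level (x : G × (ℕ →₀ ℤ)) : ∃ n, x ∈ level G n := by
  obtain ⟨n, hn⟩ := x.2.support.bddAbove
  refine ⟨n + 1, fun m hm => ?_⟩
  by_contra h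
  have := hn (Finset.mem_coe.2 (Finsupp.mem_support_iff.2 h))
  omega

variable (G) in
/-- The standard generator of the `n`-th copy of `ℤ` in `G ⊕ ℤ^(ℕ)`. -/
noncomputable def gen (n : ℕ) : G × (ℕ →₀ ℤ) := (0, Finsupp.single n 1)

theorem gen_mem_level (n : ℕ) : gen G n ∈ level G (n + 1) := by
  intro m hm
  rw [gen, Finsupp.single_apply, if_neg (by omega)]

theorem eq_zero_of_zsmul_gen_mem (n : ℕ) (k : ℤ) (h : k • gen G n ∈ level G n) : k = 0 := by
  simpa [gen] using h n le_rfl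

theorem exists_eq_add_zsmul_gen {n : ℕ} {x : G × (ℕ →₀ ℤ)} (hx : x ∈ level G (n + 1)) :
    ∃ h ∈ level G n, ∃ k : ℤ, x = h + k • gen G n := by
  refine ⟨x - x.2 n • gen G n, fun m hm => ?_, x.2 n, by abel⟩
  rcases hm.eq_or_lt with rfl | hm
  · simp [gen]
  · simp [gen, hx m hm, hm.ne]

variable [PartialOrder G]

variable (G) in
/-- A simple partial order on `G ⊕ ℤⁿ`, for some `n`, that extends the order of `G` and in which `G`
is cofinal. -/
structure Stage where
  /-- the number of copies of `ℤ` -/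
  n : ℕ
  /-- the positive cone -/
  cone : AddSubmonoid (G × (ℕ →₀ ℤ))
  isSimpleCone : IsSimpleCone (level G n) cone
  inl_mem : ∀ g : G, (g, 0) ∈ cone ↔ 0 ≤ g
  cofinal : ∀ x ∈ level G n, ∃ g : G, (g, 0) - x ∈ cone

namespace Stage

noncomputable instance : Preorder (Stage G) := Preorder.lift fun s => (s.n, s.cone)

/-- At the stage `s`, `aᵢ < bⱼ` for all `i` and `j`. -/
structure Gap (s : Stage G) (a b : Fin 2 → G × (ℕ →₀ ℤ)) : Prop where
  left_mem : ∀ i, a i ∈ level G s.n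
  right_mem : ∀ j, b j ∈ level G s.n
  strictPos : ∀ i j, StrictPos s.cone (b j - a i)

/-- At the stage `s`, there is an interpolant between the `aᵢ` and the `bⱼ`. -/
def Filled (s : Stage G) (a b : Fin 2 → G × (ℕ →₀ ℤ)) : Prop :=
  ∃ c, (∀ i, c - a i ∈ s.cone) ∧ ∀ j, b j - c ∈ s.cone

theorem Gap.exists_filled {s : Stage G} {a b : Fin 2 → G × (ℕ →₀ ℤ)} (h : s.Gap a b) :
    ∃ s', s ≤ s' ∧ s'.n = s.n + 1 ∧ s'.Filled a b := by
  have hc := eq_zero_of_zsmul_gen_mem (G := G) s.n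
  refine ⟨⟨s.n + 1, interpolationCone s.isSimpleCone h.strictPos (gen G s.n),
    isSimpleCone_interpolationCone _ _ h.left_mem h.right_mem hc (level_mono (Nat.le_succ _))
      (gen_mem_level _) fun x hx => exists_eq_add_zsmul_gen hx, fun g => ?_, fun x hx => ?_⟩,
    ⟨Nat.le_succ _, le_interpolationCone s.isSimpleCone h.strictPos⟩, rfl, gen G s.n,
    sub_lower_mem_interpolationCone s.isSimpleCone h.strictPos,
    upper_sub_mem_interpolationCone s.isSimpleCone h.strictPos⟩
  · rw [← s.inl_mem]
    exact ⟨fun hg => mem_of_mem_interpolationCone _ _ h.left_mem h.right_mem hc hg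
      (inl_mem_level _ g), fun hg => le_interpolationCone _ _ hg⟩
  · obtain ⟨z, hz, k, rfl⟩ := exists_eq_add_zsmul_gen hx
    obtain ⟨y, hy, hyx⟩ := exists_mem_sub_mem_interpolationCone s.isSimpleCone h.strictPos
      h.left_mem h.right_mem (c := gen G s.n) hz k
    obtain ⟨g, hg⟩ := s.cofinal y hy
    refine ⟨g, ?_⟩
    convert AddSubmonoid.add_mem _ (le_interpolationCone s.isSimpleCone h.strictPos hg) hyx using 1
    abel

theorem exists_le_level {u : G} (hu : 0 < u) (s : Stage G) (n : ℕ) : ∃ s', s ≤ s' ∧ n ≤ s'.n := by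
  induction n with
  | zero => exact ⟨s, le_rfl, Nat.zero_le _⟩
  | succ n ih =>
    obtain ⟨s₁, h₁, hn⟩ := ih
    have hgap : s₁.Gap (fun _ => 0) (fun _ => (u, 0)) :=
      ⟨fun _ => zero_mem _, fun _ => inl_mem_level _ u, fun _ _ => by
        rw [sub_zero]
        exact ⟨(s₁.inl_mem u).2 hu.le, fun h => hu.ne' (congrArg Prod.fst h)⟩⟩
    obtain ⟨s₂, h₂, hn₂, -⟩ := hgap.exists_filled
    exact ⟨s₂, h₁.trans h₂, by omega⟩

/-- The stages at which `n` copies of `ℤ` are present and the question whether there is to be an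
interpolant between the `aᵢ` and the `bⱼ` has been settled. -/
def settled {u : G} (hu : 0 < u)
    (q : ℕ × (Fin 2 → G × (ℕ →₀ ℤ)) × (Fin 2 → G × (ℕ →₀ ℤ))) : Order.Cofinal (Stage G) where
  carrier := {s | q.1 ≤ s.n ∧ (s.Filled q.2.1 q.2.2 ∨ ∀ s', s ≤ s' → ¬ s'.Gap q.2.1 q.2.2)}
  isCofinal s := by
    obtain ⟨s₁, h₁, hn⟩ := exists_le_level hu s q.1
    by_cases h : ∃ s₂, s₁ ≤ s₂ ∧ s₂.Gap q.2.1 q.2.2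
    · obtain ⟨s₂, h₂, hgap⟩ := h
      obtain ⟨s₃, h₃, -, hfill⟩ := hgap.exists_filled
      exact ⟨s₃, ⟨(hn.trans h₂.1).trans h₃.1, Or.inl hfill⟩, (h₁.trans h₂).trans h₃⟩
    · push Not at h
      exact ⟨s₁, ⟨hn, Or.inr h⟩, h₁⟩

/-- The order of `G` itself, as the initial stage. -/
noncomputable def initial [IsOrderedAddMonoid G] (hG : IsSimplePOGroup G) : Stage G where
  n := 0
  cone := (AddSubmonoid.nonneg G).map (AddMonoidHom.inl G (ℕ →₀ ℤ))
  isSimpleCone :=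
    { mem := by
        rintro _ ⟨g, -, rfl⟩
        exact inl_mem_level _ g
      eq_zero := by
        rintro _ ⟨g, hg, rfl⟩ ⟨h, hh, heq⟩
        have : h = -g := congrArg Prod.fst heq
        subst this
        rw [le_antisymm (neg_nonneg.1 hh) hg, map_zero]
      unit := by
        rintro _ ⟨g, hg, rfl⟩ hne ⟨x, e⟩ hx
        obtain rfl : e = 0 := Finsupp.ext fun m => hx m (Nat.zero_le m)
        obtain ⟨n, hn⟩ := (hG g (lt_of_le_of_ne hg fun h => hne (by rw [← h, map_zero]))).2 x
        exact ⟨n, n • g - x, sub_nonneg.2 hn, by simp⟩ }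
  inl_mem g := by
    constructor
    · rintro ⟨h, hh, heq⟩
      obtain rfl : h = g := congrArg Prod.fst heq
      exact hh
    · exact fun h => ⟨g, h, rfl⟩
  cofinal := by
    rintro ⟨x, e⟩ hx
    obtain rfl : e = 0 := Finsupp.ext fun m => hx m (Nat.zero_le m)
    exact ⟨x, by simp⟩

end Stage

end Union

theorem IsSimplePOGroup.isDirectedGroup {G : Type*} [AddCommGroup G] [PartialOrder G]
    [IsOrderedAddMonoid G] (h : IsSimplePOGroup G) {u : G} (hu : 0 < u) : IsDirectedGroup G := by
  intro x y
  obtain ⟨m, hm⟩ := (h u hu).2 x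
  obtain ⟨n, hn⟩ := (h u hu).2 y
  exact ⟨(m + n) • u, hm.trans (nsmul_le_nsmul_left hu.le (Nat.le_add_right m n)),
    hn.trans (nsmul_le_nsmul_left hu.le (Nat.le_add_left n m))⟩

/-- A nonzero countable torsion-free simple directed group embeds cofinally into a countable
torsion-free simple Riesz group. For simple groups, directedness amounts to the existence of an
element `u > 0` when the group is nonzero. -/
theorem exists_embedding_isRieszGroup.{u} {G : Type u} [AddCommGroup G] [PartialOrder G]
    [IsOrderedAddMonoid G] [Countable G] [IsAddTorsionFree G] (hG : IsSimplePOGroup G) {u : G}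
    (hu : 0 < u) :
    ∃ (K : Type u) (_ : AddCommGroup K) (_ : PartialOrder K) (_ : IsOrderedAddMonoid K),
      Countable K ∧ IsAddTorsionFree K ∧ IsSimplePOGroup K ∧ IsRieszGroup K ∧
      ∃ f : G →+ K, (∀ x y : G, f x ≤ f y ↔ x ≤ y) ∧ ∀ k : K, ∃ x : G, k ≤ f x := by
  let _ := Encodable.ofCountable (ℕ × (Fin 2 → G × (ℕ →₀ ℤ)) × (Fin 2 → G × (ℕ →₀ ℤ)))
  let I := Order.idealOfCofinals (Stage.initial hG) (Stage.settled hu)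
  have hI : ∀ q, ∃ s ∈ Stage.settled hu q, s ∈ I := Order.cofinal_meets_idealOfCofinals _ _
  have hlevel : ∀ x : G × (ℕ →₀ ℤ), ∃ s ∈ I, x ∈ level G s.n := by
    intro x
    obtain ⟨n, hn⟩ := exists_mem_level x
    obtain ⟨s, hs, hsI⟩ := hI (n, 0, 0)
    exact ⟨s, hsI, level_mono hs.1 hn⟩
  have hdir : ∀ s ∈ I, ∀ s' ∈ I, ∃ r ∈ I, s ≤ r ∧ s' ≤ r := I.directed
  let C : AddGroupCone (G × (ℕ →₀ ℤ)) :=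
    { carrier := {x | ∃ s ∈ I, x ∈ s.cone}
      zero_mem' := ⟨_, Order.mem_idealOfCofinals _ _, zero_mem _⟩
      add_mem' := by
        rintro x y ⟨s, hs, hx⟩ ⟨s', hs', hy⟩
        obtain ⟨r, hr, h, h'⟩ := hdir s hs s' hs'
        exact ⟨r, hr, r.cone.add_mem (h.2 hx) (h'.2 hy)⟩
      eq_zero_of_mem_of_neg_mem' := by
        rintro x ⟨s, hs, hx⟩ ⟨s', hs', hy⟩
        obtain ⟨r, hr, h, h'⟩ := hdir s hs s' hs'
        exact r.isSimpleCone.eq_zero x (h.2 hx) (h'.2 hy) }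
  let ord : PartialOrder (G × (ℕ →₀ ℤ)) := PartialOrder.mkOfAddGroupCone C
  have hmono : @IsOrderedAddMonoid _ _ ord.toPreorder := IsOrderedAddMonoid.mkOfCone C
  have hle : ∀ x y : G × (ℕ →₀ ℤ), ord.le x y ↔ ∃ s ∈ I, y - x ∈ s.cone := fun _ _ => Iff.rfl
  have hinl : ∀ x y : G, ord.le (x, 0) (y, 0) ↔ x ≤ y := by
    intro x y
    rw [hle, ← sub_nonneg]
    have hxy : ((y, 0) : G × (ℕ →₀ ℤ)) - (x, 0) = (y - x, 0) := by simp
    rw [hxy]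
    exact ⟨fun ⟨s, _, h⟩ => (s.inl_mem _).1 h,
      fun h => ⟨_, Order.mem_idealOfCofinals _ _, ((Stage.initial hG).inl_mem _).2 h⟩⟩
  have hsimple : @IsSimplePOGroup _ _ ord := by
    intro v hv
    have hv0 := @le_of_lt _ ord.toPreorder _ _ hv
    refine ⟨hv0, fun x => ?_⟩
    obtain ⟨s, hs, hx⟩ := hlevel x
    obtain ⟨s', hs', hv'⟩ := (hle _ _).1 hv0
    obtain ⟨r, hr, h, h'⟩ := hdir s hs s' hs'
    rw [sub_zero] at hv'
    obtain ⟨n, hn⟩ := r.isSimpleCone.unit v (h'.2 hv')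
      (@ne_of_gt _ ord.toPreorder _ _ hv) x (level_mono h.1 hx)
    exact ⟨n, (hle _ _).2 ⟨r, hr, hn⟩⟩
  have hu' : ord.lt 0 (u, 0) :=
    lt_of_le_of_ne ((hinl 0 u).2 hu.le) fun h => hu.ne (congrArg Prod.fst h)
  have hinterp : @HasInterpolation _ ord := by
    intro a₀ a₁ b₀ b₁ h00 h01 h10 h11
    by_cases heq : (a₀ = b₀ ∨ a₀ = b₁) ∨ (a₁ = b₀ ∨ a₁ = b₁)
    -- if some `aᵢ` equals some `bⱼ`, then it is an interpolant
    · rcases heq with heq | heq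
      · refine ⟨a₀, ord.le_refl _, ?_, h00, h01⟩
        rcases heq with rfl | rfl <;> assumption
      · refine ⟨a₁, ?_, ord.le_refl _, h10, h11⟩
        rcases heq with rfl | rfl <;> assumption
    push Not at heq
    obtain ⟨s, ⟨-, hs⟩, hsI⟩ := hI (0, ![a₀, a₁], ![b₀, b₁])
    rcases hs with ⟨c, hac, hcb⟩ | hs
    · exact ⟨c, ⟨s, hsI, hac 0⟩, ⟨s, hsI, hac 1⟩, ⟨s, hsI, hcb 0⟩, ⟨s, hsI, hcb 1⟩⟩
    -- otherwise the strict inequalities all hold at some later stage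
    · have hpos : ∀ x y : G × (ℕ →₀ ℤ), ord.le x y → x ≠ y → ∃ r ∈ I, s ≤ r ∧
          x ∈ level G r.n ∧ y ∈ level G r.n ∧ StrictPos r.cone (y - x) := by
        intro x y hxy hne
        obtain ⟨s₁, hs₁, h₁⟩ := (hle _ _).1 hxy
        obtain ⟨s₂, hs₂, h₂⟩ := hlevel x
        obtain ⟨r, hr, hr₁, hr₂⟩ := hdir s₁ hs₁ s₂ hs₂
        obtain ⟨r', hr', hr₃, hr₄⟩ := hdir r hr s hsI
        have hx := level_mono (hr₂.trans hr₃).1 h₂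
        have hd := (hr₁.trans hr₃).2 h₁
        refine ⟨r', hr', hr₄, hx, ?_, hd, sub_ne_zero.2 hne.symm⟩
        simpa using (level G r'.n).add_mem (r'.isSimpleCone.mem _ hd) hx
      obtain ⟨r₁, hr₁, hs₁, ha₀, hb₀, h₁⟩ := hpos _ _ h00 heq.1.1
      obtain ⟨r₂, hr₂, -, -, hb₁, h₂⟩ := hpos _ _ h01 heq.1.2
      obtain ⟨r₃, hr₃, -, ha₁, -, h₃⟩ := hpos _ _ h10 heq.2.1
      obtain ⟨r₄, hr₄, -, -, -, h₄⟩ := hpos _ _ h11 heq.2.2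
      obtain ⟨r, hr, h1r, h2r⟩ := hdir r₁ hr₁ r₂ hr₂
      obtain ⟨r', hr', h3r, h4r⟩ := hdir r₃ hr₃ r₄ hr₄
      obtain ⟨t, -, hrt, hrt'⟩ := hdir r hr r' hr'
      refine absurd ⟨?_, ?_, ?_⟩ (hs t ((hs₁.trans h1r).trans hrt))
      · exact Fin.forall_fin_two.2
          ⟨level_mono (h1r.trans hrt).1 ha₀, level_mono (h3r.trans hrt').1 ha₁⟩
      · exact Fin.forall_fin_two.2
          ⟨level_mono (h1r.trans hrt).1 hb₀, level_mono (h2r.trans hrt).1 hb₁⟩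
      · exact Fin.forall_fin_two.2 ⟨Fin.forall_fin_two.2
          ⟨⟨(h1r.trans hrt).2 h₁.1, h₁.2⟩, ⟨(h2r.trans hrt).2 h₂.1, h₂.2⟩⟩, Fin.forall_fin_two.2
          ⟨⟨(h3r.trans hrt').2 h₃.1, h₃.2⟩, ⟨(h4r.trans hrt').2 h₄.1, h₄.2⟩⟩⟩
  refine ⟨G × (ℕ →₀ ℤ), inferInstance, ord, hmono, inferInstance, inferInstance, hsimple,
    ⟨hsimple.isDirectedGroup hu', hinterp⟩, AddMonoidHom.inl G (ℕ →₀ ℤ), hinl, fun x => ?_⟩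
  obtain ⟨s, hs, hx⟩ := hlevel x
  obtain ⟨g, hg⟩ := s.cofinal x hx
  exact ⟨g, s, hs, hg⟩

/-! ### Transfer of the interval -/

/-- Under interpolation, the elements `z ≤ x + y` of `G⁺` with `x, y ∈ D` are sums of two elements
of `D`. -/
theorem IsInterval.exists_add_eq {G : Type*} [AddCommGroup G] [PartialOrder G]
    [IsOrderedAddMonoid G] (hG : HasInterpolation G) {D : Set G} (hD : IsInterval D) {x y z : G}
    (hx : x ∈ D) (hy : y ∈ D) (hz : 0 ≤ z) (hzxy : z ≤ x + y) :
    ∃ x' ∈ D, ∃ y' ∈ D, x' + y' = z := by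
  obtain ⟨c, hc0, hzy, hcx, hcz⟩ := hG 0 (z - y) x z (hD.subset_posCone hx) hz
    (sub_le_iff_le_add.2 hzxy) (sub_le_self z (hD.subset_posCone hy))
  exact ⟨c, hD.lower x hx c hc0 hcx, z - c, hD.lower y hy _ (sub_nonneg.2 hcz)
    (sub_le_comm.1 hzy), add_sub_cancel c z⟩

theorem IsInterval.generatedBy_image {G K : Type*} [AddCommGroup G] [PartialOrder G]
    [AddCommGroup K] [PartialOrder K] {D : Set G} (hD : IsInterval D) {f : G →+ K}
    (hf : Monotone f) : IsInterval (generatedBy (f '' D)) := by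
  have hpos : ∀ t ∈ D, 0 ≤ f t := fun t ht => by
    simpa using hf (hD.subset_posCone ht)
  refine ⟨fun _ hx => hx.1, ?_, ?_, ?_⟩
  · obtain ⟨t, ht⟩ := hD.nonempty
    exact ⟨f t, hpos t ht, f t, ⟨t, ht, rfl⟩, le_rfl⟩
  · rintro x ⟨-, _, ⟨s, hs, rfl⟩, hx⟩ y ⟨-, _, ⟨t, ht, rfl⟩, hy⟩
    obtain ⟨r, hr, hsr, htr⟩ := hD.directed s hs t ht
    exact ⟨f r, ⟨hpos r hr, f r, ⟨r, hr, rfl⟩, le_rfl⟩, hx.trans (hf hsr), hy.trans (hf htr)⟩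
  · rintro x ⟨-, t, ht, hx⟩ y hy hyx
    exact ⟨hy, t, ht, hyx.trans hx⟩

end SimpleRiesz

theorem mainTheorem12 :
    -- the rank-one example in `ℚ`, which has all the properties except interpolation
    (SimpleRiesz.IsDirectedGroup SimpleRiesz.G₀ ∧
      SimpleRiesz.IsSimplePOGroup SimpleRiesz.G₀ ∧
      SimpleRiesz.IsInterval SimpleRiesz.G₀.D₀ ∧
      SimpleRiesz.intervalSum SimpleRiesz.G₀.D₀ SimpleRiesz.G₀.D₀ =
        SimpleRiesz.posCone SimpleRiesz.G₀ ∧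
      SimpleRiesz.G₀.D₀ ≠ SimpleRiesz.posCone SimpleRiesz.G₀) ∧
    -- the countable torsion-free simple Riesz group
    ∃ (G : Type) (_ : AddCommGroup G) (_ : PartialOrder G) (_ : IsOrderedAddMonoid G) (D : Set G),
      Countable G ∧ IsAddTorsionFree G ∧
      SimpleRiesz.IsSimplePOGroup G ∧ SimpleRiesz.IsRieszGroup G ∧
      SimpleRiesz.IsInterval D ∧
      {z : G | ∃ x ∈ D, ∃ y ∈ D, x + y = z} = SimpleRiesz.posCone G ∧
      D ≠ SimpleRiesz.posCone G ∧
      -- `G₀` embeds cofinally into `G`, and `D` is generated by the image of `D₀`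
      ∃ f : SimpleRiesz.G₀ →+ G,
        (∀ x y : SimpleRiesz.G₀, f x ≤ f y ↔ x ≤ y) ∧
        (∀ g : G, ∃ x : SimpleRiesz.G₀, g ≤ f x) ∧
        D = SimpleRiesz.generatedBy (f '' SimpleRiesz.G₀.D₀) := by
  refine ⟨⟨SimpleRiesz.G₀.isSimplePOGroup.isDirectedGroup (SimpleRiesz.G₀.d_pos 0),
    SimpleRiesz.G₀.isSimplePOGroup, SimpleRiesz.G₀.isInterval_D₀, SimpleRiesz.G₀.intervalSum_D₀,
    SimpleRiesz.G₀.D₀_ne_posCone⟩, ?_⟩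
  obtain ⟨G, hgrp, hord, hmon, hcount, htf, hsimple, hRiesz, f, hf, hcof⟩ :=
    SimpleRiesz.exists_embedding_isRieszGroup SimpleRiesz.G₀.isSimplePOGroup
      (SimpleRiesz.G₀.d_pos 0)
  have hD : SimpleRiesz.IsInterval (SimpleRiesz.generatedBy (f '' SimpleRiesz.G₀.D₀)) :=
    SimpleRiesz.G₀.isInterval_D₀.generatedBy_image fun x y h => (hf x y).2 h
  refine ⟨G, hgrp, hord, hmon, _, hcount, htf, hsimple, hRiesz, hD, ?_, fun h => ?_, f, hf, hcof,
    rfl⟩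
  · refine Set.Subset.antisymm ?_ fun z hz => ?_
    · rintro _ ⟨x, hx, y, hy, rfl⟩
      exact add_nonneg (hD.subset_posCone hx) (hD.subset_posCone hy)
    · obtain ⟨x, hx⟩ := hcof z
      obtain ⟨n, hn⟩ := SimpleRiesz.G₀.exists_le_d_add_d x
      have hd : f (SimpleRiesz.G₀.d n) ∈ SimpleRiesz.generatedBy (f '' SimpleRiesz.G₀.D₀) :=
        ⟨(map_zero f).symm.trans_le ((hf _ _).2 (SimpleRiesz.G₀.d_pos n).le), _,
          ⟨_, SimpleRiesz.G₀.d_mem_D₀ n, rfl⟩, le_rfl⟩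
      refine hD.exists_add_eq hRiesz.2 hd hd hz (hx.trans ?_)
      rw [← map_add]
      exact (hf _ _).2 hn
  · have h2 : 0 ≤ 2 • SimpleRiesz.G₀.d 0 := nsmul_nonneg (SimpleRiesz.G₀.d_pos 0).le 2
    have hmem : f (2 • SimpleRiesz.G₀.d 0) ∈ SimpleRiesz.posCone G :=
      (map_zero f).symm.trans_le ((hf _ _).2 h2)
    rw [← h] at hmem
    obtain ⟨-, _, ⟨t, ht, rfl⟩, hle⟩ := hmem
    exact SimpleRiesz.G₀.two_nsmul_d_zero_notMem_D₀
      (SimpleRiesz.G₀.isInterval_D₀.lower t ht _ h2 ((hf _ _).1 hle))
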